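/- Let $X$ and $Y$ be real locally convex topological vector spaces with topological duals $X^*$ and $Y^*$, let $A\colon X\to Y$ be a continuous linear operator with adjoint $A^*\colon Y^*\to X^*$, $A^*y^*=y^*\circ A$, and let $f\colon X\to(-\infty,\infty]$ and $g\colon Y\to(-\infty,\infty]$ be proper convex functions. Write $\mathrm{dom}(h)=\{x\mid h(x)<\infty\}$ and $h^*(x^*)=\sup_x\{\langle x^*,x\rangle-h(x)\}$ for the effective domain and the Fenchel conjugate of a function $h$, and define $$\widehat p:=\inf_{x\in X}\{f(x)+g(Ax)\},\qquad \widehat d:=\sup_{y^*\in Y^*}\{-f^*(A^*y^*)-g^*(-y^*)\}.$$ For a convex set $\Omega\subset X$ let $\mathrm{qri}(\Omega)$ be the set of all $x\in\Omega$ such that the closure of $\mathrm{cone}(\Omega-x)=\{t(w-x)\mid t\ge 0,\ w\in\Omega\}$ is a linear subspace of $X$. Suppose that $g$ is polyhedral, i.e., its epigraph $\{(y,\lambda)\in Y\times\mathbb R\mid g(y)\le\lambda\}$ is the solution set of a finite system of inequalities $\langle z_i^*,z\rangle\le\alpha_i$, $i=1,\dots,k$, with $z_i^*\in(Y\times\mathbb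 R)^*$ and $\alpha_i\in\mathbb R$, and that $$\mathrm{dom}(g\circ A)\cap\mathrm{qri}(\mathrm{dom}(f))\ne\emptyset.$$ Then $\widehat p=\widehat d$. Furthermore, if $\widehat p$ is finite, then the supremum in the definition of $\widehat d$ is attained at some $y^*\in Y^*$. -/

import Mathlib

namespace FenchelDuality

/-- The conic hull `cone(A) = {t • a | t ≥ 0, a ∈ A}`. -/
def coneHull {X : Type*} [AddCommGroup X] [Module ℝ X] (A : Set X) : Set X :=
  {y | ∃ t : ℝ, 0 ≤ t ∧ ∃ a ∈ A, y = t • a}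

/-- The quasi-relative interior of `Ω`: the points `x ∈ Ω` for which the closure of
`cone(Ω - x)` is a linear subspace. -/
def qri {X : Type*} [AddCommGroup X] [Module ℝ X] [TopologicalSpace X] (Ω : Set X) : Set X :=
  {x | x ∈ Ω ∧ ∃ S : Submodule ℝ X, (S : Set X) = closure (coneHull ((fun w => w - x) '' Ω))}

/-- A polyhedral set (convex polyhedron): the solution set of a finite (possibly empty) system
of inequalities given by continuous linear functionals. -/
def IsPolyhedralSet {X : Type*} [AddCommGroup X] [Module ℝ X] [TopologicalSpace X]
    (P : Set X) : Prop :=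
  ∃ (k : ℕ) (φ : Fin k → StrongDual ℝ X) (α : Fin k → ℝ), P = {x | ∀ i, φ i x ≤ α i}

/-- The effective domain of an extended-real-valued function. -/
def effDom {X : Type*} (f : X → EReal) : Set X := {x | f x < ⊤}

/-- The epigraph of an extended-real-valued function, as a subset of `X × ℝ`. -/
def epi {X : Type*} (f : X → EReal) : Set (X × ℝ) := {p | f p.1 ≤ (p.2 : EReal)}

/-- `f` takes values in `(-∞, ∞]` and is not identically `∞`. -/
def IsProper {X : Type*} (f : X → EReal) : Prop := (∀ x, f x ≠ ⊥) ∧ (effDom f).Nonempty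

/-- Convexity of an extended-real-valued function, i.e. of its epigraph. -/
def IsConvexFun {X : Type*} [AddCommGroup X] [Module ℝ X] (f : X → EReal) : Prop :=
  Convex ℝ (epi f)

/-- A polyhedral function: its epigraph is a convex polyhedron in `X × ℝ`. -/
def IsPolyhedralFun {X : Type*} [AddCommGroup X] [Module ℝ X] [TopologicalSpace X]
    (f : X → EReal) : Prop :=
  IsPolyhedralSet (epi f)

/-- The Fenchel conjugate `f*(x*) = sup_x (⟨x*, x⟩ - f x)`. -/
noncomputable def conjugate {X : Type*} [AddCommGroup X] [Module ℝ X] [TopologicalSpace X]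
    (f : X → EReal) (φ : StrongDual ℝ X) : EReal :=
  ⨆ x : X, ((φ x : ℝ) : EReal) - f x

section Problem

variable {X Y : Type*} [AddCommGroup X] [Module ℝ X] [TopologicalSpace X]
  [AddCommGroup Y] [Module ℝ Y] [TopologicalSpace Y]

/-- The optimal value `inf_x (f x + g (A x))` of the primal problem. -/
noncomputable def primalValue (f : X → EReal) (g : Y → EReal) (A : X →L[ℝ] Y) : EReal :=
  ⨅ x : X, f x + g (A x)

/-- The objective `-f*(A* y*) - g*(-y*)` of the Fenchel dual problem; the adjoint is
`A* y* = y* ∘ A`. -/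
noncomputable def dualObjective (f : X → EReal) (g : Y → EReal) (A : X →L[ℝ] Y)
    (η : StrongDual ℝ Y) : EReal :=
  -conjugate f (η.comp A) - conjugate g (-η)

/-- The optimal value of the Fenchel dual problem. -/
noncomputable def dualValue (f : X → EReal) (g : Y → EReal) (A : X →L[ℝ] Y) : EReal :=
  ⨆ η : StrongDual ℝ Y, dualObjective f g A η

end Problem

end FenchelDuality

/-!
Weak duality is immediate, so only the case of a finite primal value `p` needs work. If the
epigraph of `g` is `{(y, s) | ∀ i, z i (y, s) ≤ α i}`, the primal problem becomes the minimization
of the linear functional `r + s` over the convex set `{(x, r, s) | f x ≤ r}`, subject to the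
finitely many linear inequalities `z i (A x, s) ≤ α i`. A dual solution is read off from a
vector of Lagrange multipliers `μ ≥ 0` for these inequalities, namely
`η y = -∑ i, μ i * z i (y, 0)`.

The multipliers come from `exists_multipliers`, a purely algebraic statement about a convex set
`S` and linear functionals `ℓ i`. Its constraint qualification at a feasible point `w₀` is
that a linear combination of the `ℓ i` which attains its minimum over `S` at `w₀` is constant on
`S`. For points of the quasi-relative interior this holds because a continuous functional that
is nonnegative on `cone (Ω - x)` is nonnegative on the closure, which is a subspace, and hence
vanishes (`eq_zero_of_mem_qri`).

The multipliers are found by induction on the number of constraints. Let `ℓ k` be a new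
constraint. If it can be satisfied strictly within the remaining ones, Slater's one-constraint
argument moves it into the objective. Otherwise the induction hypothesis, applied to the objective
`ℓ k`, together with the qualification shows that a nonnegative combination of the constraint
functions, with coefficient `1` at `k`, vanishes identically on `S`. The constraint `k` then holds
with equality at all feasible points. One solves the problem on the slice of `S` where it is an
equality, extends the inequality from the slice to `S` with a multiplier of arbitrary sign, and
repairs the sign by adding a multiple of the vanishing combination.
-/

namespace FenchelDuality

open Finset

/-! ### Lagrange multipliers for linear constraints on a convex set -/

section Multipliers

variable {W : Type*} [AddCommGroup W] [Module ℝ W]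

/-- Lagrange multiplier for one linear equality `h = a` on a convex set `S`: the hyperplane
must either contain `S` or have points of `S` strictly on both sides. -/
lemma exists_multiplier_of_eq {S : Set W} (hS : Convex ℝ S) (o h : W →ₗ[ℝ] ℝ) {p a : ℝ}
    (hpos : (∀ w ∈ S, a ≤ h w) → ∀ w ∈ S, h w = a)
    (hneg : (∀ w ∈ S, h w ≤ a) → ∀ w ∈ S, h w = a)
    (hp : ∀ w ∈ S, h w = a → p ≤ o w) :
    ∃ μ : ℝ, ∀ w ∈ S, p ≤ o w + μ * (h w - a) := by
  by_cases h1 : ∀ w ∈ S, a ≤ h w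
  · exact ⟨0, fun w hw => by simpa using hp w hw (hpos h1 w hw)⟩
  by_cases h2 : ∀ w ∈ S, h w ≤ a
  · exact ⟨0, fun w hw => by simpa using hp w hw (hneg h2 w hw)⟩
  push Not at h1 h2
  obtain ⟨u, hu, hua⟩ := h1
  obtain ⟨v, hv, hva⟩ := h2
  -- `μ` has to separate the lower bounds imposed by the points with `a < h` from the upper bounds
  -- imposed by the points with `h < a`.
  obtain ⟨μ, hμ1, hμ2⟩ := exists_between_of_forall_le
    (s := (fun w => (p - o w) / (h w - a)) '' {w | w ∈ S ∧ a < h w})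
    (t := (fun w => (o w - p) / (a - h w)) '' {w | w ∈ S ∧ h w < a})
    ⟨_, v, ⟨hv, hva⟩, rfl⟩ ⟨_, u, ⟨hu, hua⟩, rfl⟩ (by
      rintro _ ⟨x, ⟨hx, hxa⟩, rfl⟩ _ ⟨y, ⟨hy, hya⟩, rfl⟩
      have hx' : 0 < h x - a := sub_pos.2 hxa
      have hy' : 0 < a - h y := sub_pos.2 hya
      have hd : 0 < h x - h y := by linarith
      -- The segment from `x` to `y` meets the hyperplane at this convex combination.
      have key := hp _ (hS hx hy (a := (a - h y) / (h x - h y)) (b := (h x - a) / (h x - h y))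
        (by positivity) (by positivity) (by field_simp; ring)) (by
          simp only [map_add, map_smul, smul_eq_mul]; field_simp; ring)
      simp only [map_add, map_smul, smul_eq_mul] at key
      have e : (a - h y) / (h x - h y) * o x + (h x - a) / (h x - h y) * o y
          = ((a - h y) * o x + (h x - a) * o y) / (h x - h y) := by ring
      rw [e, le_div_iff₀ hd] at key
      dsimp only
      rw [div_le_div_iff₀ hx' hy']
      linarith)
  refine ⟨μ, fun w hw => ?_⟩
  rcases lt_trichotomy (h w) a with hlt | heq | hgt
  · have := hμ2 ⟨w, ⟨hw, hlt⟩, rfl⟩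
    dsimp only at this
    rw [le_div_iff₀ (sub_pos.2 hlt)] at this
    linarith
  · simpa [heq] using hp w hw heq
  · have := hμ1 ⟨w, ⟨hw, hgt⟩, rfl⟩
    dsimp only at this
    rw [div_le_iff₀ (sub_pos.2 hgt)] at this
    linarith

/-- Lagrange multiplier for one linear inequality `h ≤ a` under Slater's condition. -/
lemma exists_multiplier_of_slater {S : Set W} (hS : Convex ℝ S) (o h : W →ₗ[ℝ] ℝ) {p a : ℝ}
    (hslater : ∃ w ∈ S, h w < a) (hp : ∀ w ∈ S, h w ≤ a → p ≤ o w) :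
    ∃ μ : ℝ, 0 ≤ μ ∧ ∀ w ∈ S, p ≤ o w + μ * (h w - a) := by
  by_cases hle : ∀ w ∈ S, h w ≤ a
  · exact ⟨0, le_rfl, fun w hw => by simpa using hp w hw (hle w hw)⟩
  obtain ⟨u, hu, hua⟩ := hslater
  obtain ⟨μ, hμ⟩ := exists_multiplier_of_eq hS o h (p := p) (a := a)
    (fun H => absurd (H u hu) (not_le.2 hua)) (fun H => absurd H hle)
    (fun w hw he => hp w hw he.le)
  refine ⟨max μ 0, le_max_right _ _, fun w hw => ?_⟩
  rcases le_total μ 0 with h0 | h0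
  · rw [max_eq_right h0]
    rcases le_total (h w) a with ha | ha
    · simpa using hp w hw ha
    · nlinarith [hμ w hw, mul_nonneg (neg_nonneg.2 h0) (sub_nonneg.2 ha)]
  · rw [max_eq_left h0]
    exact hμ w hw

/-- Lagrange multipliers for finitely many linear inequalities on a convex set. The hypothesis
`hQ` says that a linear combination of the constraints which is minimal over `S` at the feasible
point `w₀` is constant on `S`; no constraint has to hold strictly. -/
lemma exists_multipliers {ι : Type*} (ℓ : ι → W →ₗ[ℝ] ℝ) (α : ι → ℝ) (w₀ : W) (s : Finset ι)
    {S : Set W} (hS : Convex ℝ S) (hw₀ : w₀ ∈ S) (hfeas : ∀ i ∈ s, ℓ i w₀ ≤ α i)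
    (hQ : ∀ c : ι → ℝ, (∀ w ∈ S, 0 ≤ ∑ i ∈ s, c i * (ℓ i w - ℓ i w₀)) →
      ∀ w ∈ S, ∑ i ∈ s, c i * (ℓ i w - ℓ i w₀) = 0)
    (o : W →ₗ[ℝ] ℝ) (p : ℝ) (hp : ∀ w ∈ S, (∀ i ∈ s, ℓ i w ≤ α i) → p ≤ o w) :
    ∃ μ : ι → ℝ, (∀ i, 0 ≤ μ i) ∧ ∀ w ∈ S, p ≤ o w + ∑ i ∈ s, μ i * (ℓ i w - α i) := by
  classical
  induction s using Finset.induction_on generalizing S o p with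
  | empty => exact ⟨0, fun _ => le_rfl, fun w hw => by simpa using hp w hw (by simp)⟩
  | insert k t hk ih =>
    have hfeas_t : ∀ i ∈ t, ℓ i w₀ ≤ α i := fun i hi => hfeas i (mem_insert_of_mem hi)
    -- Coefficient vectors on `insert k t` with a prescribed value at `k`.
    have hsum : ∀ (c : ι → ℝ) (b : ℝ) (F : ι → ℝ),
        ∑ i ∈ insert k t, Function.update c k b i * F i = b * F k + ∑ i ∈ t, c i * F i := by
      intro c b F
      rw [sum_insert hk, Function.update_self]
      congr 1
      refine sum_congr rfl fun i hi => ?_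
      rw [Function.update_of_ne (ne_of_mem_of_not_mem hi hk)]
    have hupd : ∀ (c : ι → ℝ) (b : ℝ), (∀ i, 0 ≤ c i) → 0 ≤ b →
        ∀ i, 0 ≤ Function.update c k b i := by
      intro c b hc hb i
      rcases eq_or_ne i k with rfl | hi
      · simpa using hb
      · simpa [Function.update_of_ne hi] using hc i
    have hQ_update : ∀ (c : ι → ℝ) (b : ℝ),
        (∀ w ∈ S, 0 ≤ b * (ℓ k w - ℓ k w₀) + ∑ i ∈ t, c i * (ℓ i w - ℓ i w₀)) →
        ∀ w ∈ S, b * (ℓ k w - ℓ k w₀) + ∑ i ∈ t, c i * (ℓ i w - ℓ i w₀) = 0 := by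
      intro c b H w hw
      have := hQ (Function.update c k b) (fun w hw => by rw [hsum]; exact H w hw) w hw
      rwa [hsum] at this
    have hQt : ∀ c : ι → ℝ, (∀ w ∈ S, 0 ≤ ∑ i ∈ t, c i * (ℓ i w - ℓ i w₀)) →
        ∀ w ∈ S, ∑ i ∈ t, c i * (ℓ i w - ℓ i w₀) = 0 := by
      intro c H w hw
      simpa using hQ_update c 0 (by simpa using H) w hw
    have hT : Convex ℝ {w | w ∈ S ∧ ∀ i ∈ t, ℓ i w ≤ α i} := by
      have : {w | w ∈ S ∧ ∀ i ∈ t, ℓ i w ≤ α i} = S ∩ ⋂ i ∈ t, {w | ℓ i w ≤ α i} := by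
        ext w; simp
      rw [this]
      exact hS.inter (convex_iInter₂ fun i _ => convex_halfSpace_le (ℓ i).isLinear (α i))
    by_cases hsl : ∃ w ∈ {w | w ∈ S ∧ ∀ i ∈ t, ℓ i w ≤ α i}, ℓ k w < α k
    · obtain ⟨μk, hμk, H⟩ := exists_multiplier_of_slater hT o (ℓ k) (p := p) hsl
        (fun w hw hwk => hp w hw.1 (forall_mem_insert _ _ _ |>.2 ⟨hwk, hw.2⟩))
      obtain ⟨μ, hμ, Hμ⟩ := ih hS hw₀ hfeas_t hQt (o + μk • ℓ k) (p + μk * α k)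
        (fun w hw hwt => by
          have := H w ⟨hw, hwt⟩
          simp only [LinearMap.add_apply, LinearMap.smul_apply, smul_eq_mul]
          linarith)
      refine ⟨Function.update μ k μk, hupd μ μk hμ hμk, fun w hw => ?_⟩
      have := Hμ w hw
      simp only [LinearMap.add_apply, LinearMap.smul_apply, smul_eq_mul] at this
      rw [hsum]
      linarith
    · have htight : ∀ w ∈ S, (∀ i ∈ t, ℓ i w ≤ α i) → α k ≤ ℓ k w := by
        intro w hw hwt
        by_contra hlt
        exact hsl ⟨w, ⟨hw, hwt⟩, not_le.1 hlt⟩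
      have hk0 : ℓ k w₀ = α k :=
        le_antisymm (hfeas k (mem_insert_self _ _)) (htight w₀ hw₀ hfeas_t)
      obtain ⟨ν, hν, Hν⟩ := ih hS hw₀ hfeas_t hQt (ℓ k) (α k) htight
      have hν0 : ∑ i ∈ t, ν i * (ℓ i w₀ - α i) = 0 := by
        refine le_antisymm (sum_nonpos fun i hi => ?_) ?_
        · exact mul_nonpos_of_nonneg_of_nonpos (hν i) (sub_nonpos.2 (hfeas_t i hi))
        · have := Hν w₀ hw₀
          linarith
      have hshift : ∀ w, ∑ i ∈ t, ν i * (ℓ i w - ℓ i w₀) = ∑ i ∈ t, ν i * (ℓ i w - α i) := by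
        intro w
        rw [← sub_zero (∑ i ∈ t, ν i * (ℓ i w - α i)), ← hν0, ← sum_sub_distrib]
        exact sum_congr rfl fun i _ => by ring
      have hvanish : ∀ w ∈ S, (ℓ k w - α k) + ∑ i ∈ t, ν i * (ℓ i w - α i) = 0 := by
        intro w hw
        have := hQ_update ν 1 (fun w hw => by
          rw [hshift, hk0]
          have := Hν w hw
          linarith) w hw
        rwa [hshift, hk0, one_mul] at this
      -- The hyperplane of the constraint `k` contains `S` or strictly separates points of `S`.
      have hpos : (∀ w ∈ S, α k ≤ ℓ k w) → ∀ w ∈ S, ℓ k w = α k := by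
        intro H w hw
        have := hQ_update 0 1 (fun w hw => by simpa [hk0] using H w hw) w hw
        simp only [hk0, one_mul, Pi.zero_apply, zero_mul, sum_const_zero, add_zero] at this
        linarith
      have hneg : (∀ w ∈ S, ℓ k w ≤ α k) → ∀ w ∈ S, ℓ k w = α k := by
        intro H w hw
        have := hQ_update 0 (-1) (fun w hw => by simpa [hk0] using H w hw) w hw
        simp only [hk0, Pi.zero_apply, zero_mul, sum_const_zero, add_zero] at this
        linarith
      have hS' : Convex ℝ (S ∩ {w | ℓ k w = α k}) :=
        hS.inter (convex_hyperplane (ℓ k).isLinear (α k))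
      -- The slice inherits the qualification: a combination minimal on it at `w₀` becomes, after
      -- adding a multiple of `ℓ k`, minimal on all of `S`.
      have hQ' : ∀ c : ι → ℝ,
          (∀ w ∈ S ∩ {w | ℓ k w = α k}, 0 ≤ ∑ i ∈ t, c i * (ℓ i w - ℓ i w₀)) →
          ∀ w ∈ S ∩ {w | ℓ k w = α k}, ∑ i ∈ t, c i * (ℓ i w - ℓ i w₀) = 0 := by
        intro c H w hw
        have hc : ∀ w, (∑ i ∈ t, c i • ℓ i) w - (∑ i ∈ t, c i • ℓ i) w₀
            = ∑ i ∈ t, c i * (ℓ i w - ℓ i w₀) := by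
          intro w
          simp only [LinearMap.sum_apply, LinearMap.smul_apply, smul_eq_mul, mul_sub,
            sum_sub_distrib]
        obtain ⟨b, hb⟩ := exists_multiplier_of_eq hS (∑ i ∈ t, c i • ℓ i) (ℓ k)
          (p := (∑ i ∈ t, c i • ℓ i) w₀) hpos hneg
          (fun w hw hwk => sub_nonneg.1 (by rw [hc]; exact H w ⟨hw, hwk⟩))
        have := hQ_update c b (fun w hw => by
          rw [← hc, hk0]
          have := hb w hw
          linarith) w hw.1
        have hwk : ℓ k w = α k := hw.2
        rwa [hk0, hwk, sub_self, mul_zero, zero_add] at this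
      obtain ⟨μ, hμ, Hμ⟩ := ih hS' ⟨hw₀, hk0⟩ hfeas_t hQ' o p
        (fun w hw hwt => hp w hw.1 (forall_mem_insert _ _ _ |>.2 ⟨le_of_eq hw.2, hwt⟩))
      have hc : ∀ w, (o + ∑ i ∈ t, μ i • ℓ i) w - ∑ i ∈ t, μ i * α i
          = o w + ∑ i ∈ t, μ i * (ℓ i w - α i) := by
        intro w
        simp only [LinearMap.add_apply, LinearMap.sum_apply, LinearMap.smul_apply, smul_eq_mul,
          mul_sub, sum_sub_distrib, add_sub_assoc]
      obtain ⟨b, hb⟩ := exists_multiplier_of_eq hS (o + ∑ i ∈ t, μ i • ℓ i) (ℓ k)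
        (p := p + ∑ i ∈ t, μ i * α i) hpos hneg (fun w hw hwk => by
          have := Hμ w ⟨hw, hwk⟩
          rw [← hc] at this
          linarith)
      -- `b` may be negative; adding `|b|` times the vanishing combination makes it nonnegative.
      refine ⟨Function.update (fun i => μ i + |b| * ν i) k (b + |b|),
        hupd _ _ (fun i => add_nonneg (hμ i) (mul_nonneg (abs_nonneg b) (hν i)))
          (by linarith [neg_abs_le b]), fun w hw => ?_⟩
      rw [hsum]
      have h1 := hb w hw
      have h2 := hc w
      have h3 := congrArg (|b| * ·) (hvanish w hw)
      have h4 : ∑ i ∈ t, (μ i + |b| * ν i) * (ℓ i w - α i)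
          = ∑ i ∈ t, μ i * (ℓ i w - α i) + |b| * ∑ i ∈ t, ν i * (ℓ i w - α i) := by
        rw [mul_sum, ← sum_add_distrib]
        exact sum_congr rfl fun i _ => by ring
      simp only [mul_add, mul_zero] at h3
      rw [h4]
      linarith

end Multipliers

/-! ### The quasi-relative interior and support functionals -/

/-- A continuous linear functional minimal over `Ω` at a point of `qri Ω` is constant on `Ω`. -/
lemma eq_zero_of_mem_qri {X : Type*} [AddCommGroup X] [Module ℝ X] [TopologicalSpace X]
    {Ω : Set X} {x₀ : X} (hx₀ : x₀ ∈ qri Ω) (ψ : StrongDual ℝ X)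
    (hψ : ∀ x ∈ Ω, 0 ≤ ψ (x - x₀)) : ∀ x ∈ Ω, ψ (x - x₀) = 0 := by
  obtain ⟨-, M, hM⟩ := hx₀
  have hnonneg : ∀ v ∈ M, 0 ≤ ψ v := by
    have hcl : closure (coneHull ((fun w => w - x₀) '' Ω)) ⊆ {v | 0 ≤ ψ v} := by
      refine closure_minimal ?_ (isClosed_le continuous_const ψ.continuous)
      rintro _ ⟨t, ht, _, ⟨w, hw, rfl⟩, rfl⟩
      simpa using mul_nonneg ht (hψ w hw)
    rw [← hM] at hcl
    exact fun v hv => hcl hv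
  intro x hx
  have hmem : x - x₀ ∈ M := by
    rw [← SetLike.mem_coe, hM]
    exact subset_closure ⟨1, zero_le_one, _, ⟨x, hx, rfl⟩, (one_smul ℝ _).symm⟩
  have h1 := hnonneg _ (M.neg_mem hmem)
  rw [map_neg] at h1
  exact le_antisymm (by linarith) (hψ x hx)

/-! ### Fenchel duality -/

section Duality

variable {X Y : Type*} [AddCommGroup X] [Module ℝ X] [TopologicalSpace X]
  [AddCommGroup Y] [Module ℝ Y] [TopologicalSpace Y]

lemma dualObjective_le (f : X → EReal) (g : Y → EReal) (A : X →L[ℝ] Y)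
    (hf : ∀ x, f x ≠ ⊥) (hg : ∀ y, g y ≠ ⊥) (η : StrongDual ℝ Y) (x : X) :
    dualObjective f g A η ≤ f x + g (A x) := by
  by_cases hfx : f x = ⊤
  · rw [hfx, EReal.top_add_of_ne_bot (hg _)]; exact le_top
  by_cases hgx : g (A x) = ⊤
  · rw [hgx, EReal.add_top_of_ne_bot (hf _)]; exact le_top
  lift f x to ℝ using ⟨hfx, hf x⟩ with r hr
  lift g (A x) to ℝ using ⟨hgx, hg _⟩ with s hs
  have h1 : ((η (A x) - r : ℝ) : EReal) ≤ conjugate f (η.comp A) := by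
    refine le_iSup_of_le x ?_
    rw [← hr, EReal.coe_sub]; rfl
  have h2 : ((-η (A x) - s : ℝ) : EReal) ≤ conjugate g (-η) := by
    refine le_iSup_of_le (A x) ?_
    rw [← hs, EReal.coe_sub]; rfl
  calc dualObjective f g A η
      ≤ -((η (A x) - r : ℝ) : EReal) - ((-η (A x) - s : ℝ) : EReal) :=
        EReal.sub_le_sub (EReal.neg_le_neg_iff.2 h1) h2
    _ = (r : EReal) + s := by
        rw [← EReal.coe_neg, ← EReal.coe_sub, ← EReal.coe_add]
        congr 1; ring

lemma dualValue_le_primalValue (f : X → EReal) (g : Y → EReal) (A : X →L[ℝ] Y)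
    (hf : ∀ x, f x ≠ ⊥) (hg : ∀ y, g y ≠ ⊥) : dualValue f g A ≤ primalValue f g A :=
  iSup_le fun η => le_iInf fun x => dualObjective_le f g A hf hg η x

/-- Every real lower bound of the primal value is also a lower bound of the dual objective at a
suitable `η`, built from the Lagrange multipliers for the inequalities that define `epi g`. -/
lemma exists_le_dualObjective (f : X → EReal) (g : Y → EReal) (A : X →L[ℝ] Y)
    (hf : ∀ x, f x ≠ ⊥) (hf_conv : IsConvexFun f)
    (hg : ∀ y, g y ≠ ⊥) (hg_poly : IsPolyhedralFun g) {x₀ : X}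
    (hx₀ : x₀ ∈ qri (effDom f)) (hgx₀ : g (A x₀) < ⊤) {p : ℝ}
    (hp : (p : EReal) ≤ primalValue f g A) :
    ∃ η : StrongDual ℝ Y, (p : EReal) ≤ dualObjective f g A η := by
  obtain ⟨k, z, α, hz⟩ := hg_poly
  have hepi : ∀ (y : Y) (s : ℝ), g y ≤ s ↔ ∀ i, z i (y, s) ≤ α i := fun y s =>
    Set.ext_iff.1 hz (y, s)
  -- The coordinates of `(x, r, s)` stand for a point, a bound for `f x` and one for `g (A x)`.
  let S : Set (X × ℝ × ℝ) := {w | f w.1 ≤ (w.2.1 : EReal)}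
  let ℓ : Fin k → (X × ℝ × ℝ) →ₗ[ℝ] ℝ := fun i =>
    (z i : (Y × ℝ) →ₗ[ℝ] ℝ) ∘ₗ
      ((A : X →ₗ[ℝ] Y).prodMap (LinearMap.snd ℝ ℝ ℝ))
  let o : (X × ℝ × ℝ) →ₗ[ℝ] ℝ :=
    (LinearMap.fst ℝ ℝ ℝ + LinearMap.snd ℝ ℝ ℝ) ∘ₗ LinearMap.snd ℝ X (ℝ × ℝ)
  have hℓ : ∀ i x r s, ℓ i (x, r, s) = z i (A x, s) := fun _ _ _ _ => rfl
  have hz_split : ∀ i y (s : ℝ), z i (y, s) = z i (y, 0) + s * z i (0, 1) := by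
    intro i y s
    rw [← smul_eq_mul, ← map_smul, ← map_add]
    simp
  have hS : Convex ℝ S :=
    hf_conv.linear_preimage ((LinearMap.id).prodMap (LinearMap.fst ℝ ℝ ℝ))
  have hfx₀ : f x₀ < ⊤ := hx₀.1
  obtain ⟨r₀, hr₀⟩ : ∃ r : ℝ, (r : EReal) = f x₀ :=
    ⟨_, EReal.coe_toReal hfx₀.ne (hf _)⟩
  obtain ⟨s₀, hs₀⟩ : ∃ s : ℝ, (s : EReal) = g (A x₀) :=
    ⟨_, EReal.coe_toReal hgx₀.ne (hg _)⟩
  obtain ⟨μ, hμ, H⟩ := exists_multipliers ℓ α (x₀, r₀, s₀) univ hS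
    (show f x₀ ≤ r₀ from hr₀.ge) (fun i _ => (hepi _ _).1 hs₀.ge i) (by
      intro c hc
      have hlin : ∀ x r s, ∑ i, c i * (ℓ i (x, r, s) - ℓ i (x₀, r₀, s₀))
          = ∑ i, c i * z i (A (x - x₀), 0) + (s - s₀) * ∑ i, c i * z i (0, 1) := by
        intro x r s
        rw [mul_sum, ← sum_add_distrib]
        refine sum_congr rfl fun i _ => ?_
        have : z i (A (x - x₀), 0) = z i (A x, 0) - z i (A x₀, 0) := by
          rw [← map_sub]; simp
        rw [hℓ, hℓ, hz_split i (A x), hz_split i (A x₀), this]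
        ring
      -- The coordinate `s` is unrestricted in `S`, so its coefficient vanishes.
      have hzero : ∑ i, c i * z i (0, 1) = 0 := by
        have h1 := hc (x₀, r₀, s₀ + 1) (show f x₀ ≤ r₀ from hr₀.ge)
        have h2 := hc (x₀, r₀, s₀ - 1) (show f x₀ ≤ r₀ from hr₀.ge)
        rw [hlin, sub_self, map_zero, ← Prod.zero_eq_mk] at h1 h2
        simp only [map_zero, mul_zero, sum_const_zero] at h1 h2
        linarith
      let ψ : StrongDual ℝ X := ∑ i, c i • (z i).comp ((ContinuousLinearMap.inl ℝ Y ℝ).comp A)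
      have hψ : ∀ x, ψ x = ∑ i, c i * z i (A x, 0) := by
        intro x
        simp [ψ]
      have hψ0 := eq_zero_of_mem_qri hx₀ ψ (by
        intro x hx
        have hx' : f x = ((f x).toReal : EReal) :=
          (EReal.coe_toReal (ne_of_lt hx) (hf x)).symm
        have := hc (x, (f x).toReal, s₀) hx'.le
        rwa [hlin, hzero, mul_zero, add_zero, ← hψ] at this)
      rintro ⟨x, r, s⟩ hw
      rw [hlin, hzero, mul_zero, add_zero, ← hψ]
      exact hψ0 x (lt_of_le_of_lt hw (EReal.coe_lt_top r))) o p (by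
      rintro ⟨x, r, s⟩ hw hle
      have h1 : (p : EReal) ≤ (r : EReal) + s :=
        (hp.trans (iInf_le _ x)).trans
          (add_le_add hw ((hepi _ _).2 fun i => hle i (mem_univ i)))
      exact_mod_cast h1)
  have H' : ∀ (x : X) (r s : ℝ), f x ≤ (r : EReal) →
      p ≤ r + ∑ i, μ i * z i (A x, 0) - ∑ i, μ i * α i + s * (1 + ∑ i, μ i * z i (0, 1)) := by
    intro x r s hx
    have h1 := H (x, r, s) hx
    have h2 : ∑ i, μ i * (ℓ i (x, r, s) - α i) = ∑ i, μ i * z i (A x, 0) - ∑ i, μ i * α i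
        + s * ∑ i, μ i * z i (0, 1) := by
      rw [mul_sum, ← sum_sub_distrib, ← sum_add_distrib]
      refine sum_congr rfl fun i _ => ?_
      rw [hℓ, hz_split]
      ring
    have h3 : o (x, r, s) = r + s := rfl
    rw [h2, h3] at h1
    linarith
  -- An affine function of `s ∈ ℝ` that is bounded below is constant.
  have hone : 1 + ∑ i, μ i * z i (0, 1) = 0 := by
    by_contra hne
    have h1 := H' x₀ r₀ ((p - 1 - (r₀ + ∑ i, μ i * z i (A x₀, 0) - ∑ i, μ i * α i))
      / (1 + ∑ i, μ i * z i (0, 1))) hr₀.ge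
    rw [div_mul_cancel₀ _ hne] at h1
    linarith
  let η : StrongDual ℝ Y := -∑ i, μ i • (z i).comp (ContinuousLinearMap.inl ℝ Y ℝ)
  have hη : ∀ y, η y = -∑ i, μ i * z i (y, 0) := by
    intro y
    simp [η]
  refine ⟨η, ?_⟩
  have hfc : conjugate f (η.comp A) ≤ ((-p - ∑ i, μ i * α i : ℝ) : EReal) := by
    refine iSup_le fun x => ?_
    by_cases hfx : f x = ⊤
    · rw [hfx, EReal.sub_top]; exact bot_le
    obtain ⟨r, hr⟩ : ∃ r : ℝ, (r : EReal) = f x := ⟨_, EReal.coe_toReal hfx (hf _)⟩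
    have h1 := H' x r 0 hr.ge
    rw [← hr, ← EReal.coe_sub, EReal.coe_le_coe_iff, ContinuousLinearMap.comp_apply, hη]
    linarith
  have hgc : conjugate g (-η) ≤ ((∑ i, μ i * α i : ℝ) : EReal) := by
    refine iSup_le fun y => ?_
    by_cases hgy : g y = ⊤
    · rw [hgy, EReal.sub_top]; exact bot_le
    obtain ⟨s, hs⟩ : ∃ s : ℝ, (s : EReal) = g y := ⟨_, EReal.coe_toReal hgy (hg _)⟩
    have h1 : ∑ i, μ i * z i (y, s) ≤ ∑ i, μ i * α i :=
      sum_le_sum fun i _ => mul_le_mul_of_nonneg_left ((hepi y s).1 hs.ge i) (hμ i)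
    have h2 : ∑ i, μ i * z i (y, s) = ∑ i, μ i * z i (y, 0) + s * ∑ i, μ i * z i (0, 1) := by
      rw [mul_sum, ← sum_add_distrib]
      refine sum_congr rfl fun i _ => ?_
      rw [hz_split]
      ring
    have h3 : ∑ i, μ i * z i (0, 1) = -1 := by linarith
    rw [h2, h3] at h1
    rw [← hs, ← EReal.coe_sub, EReal.coe_le_coe_iff, neg_apply, hη]
    linarith
  calc (p : EReal)
      = -((-p - ∑ i, μ i * α i : ℝ) : EReal) - ((∑ i, μ i * α i : ℝ) : EReal) := by
        rw [← EReal.coe_neg, ← EReal.coe_sub]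
        congr 1; ring
    _ ≤ dualObjective f g A η := EReal.sub_le_sub (EReal.neg_le_neg_iff.2 hfc) hgc

end Duality

end FenchelDuality

theorem theorem6p7 {X Y : Type*}
    [AddCommGroup X] [Module ℝ X] [TopologicalSpace X] [IsTopologicalAddGroup X]
    [ContinuousSMul ℝ X] [LocallyConvexSpace ℝ X]
    [AddCommGroup Y] [Module ℝ Y] [TopologicalSpace Y] [IsTopologicalAddGroup Y]
    [ContinuousSMul ℝ Y] [LocallyConvexSpace ℝ Y]
    (f : X → EReal) (g : Y → EReal) (A : X →L[ℝ] Y)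
    (hf : FenchelDuality.IsProper f) (hf_conv : FenchelDuality.IsConvexFun f)
    (hg : FenchelDuality.IsProper g) (hg_conv : FenchelDuality.IsConvexFun g)
    (hg_poly : FenchelDuality.IsPolyhedralFun g)
    (hQ : (FenchelDuality.effDom (fun x => g (A x)) ∩
      FenchelDuality.qri (FenchelDuality.effDom f)).Nonempty) :
    FenchelDuality.primalValue f g A = FenchelDuality.dualValue f g A ∧
      ((∃ r : ℝ, FenchelDuality.primalValue f g A = (r : EReal)) →
        ∃ η : StrongDual ℝ Y,
          FenchelDuality.dualObjective f g A η = FenchelDuality.dualValue f g A) := by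
  have hweak := FenchelDuality.dualValue_le_primalValue f g A hf.1 hg.1
  obtain ⟨x₀, hgx₀, hx₀⟩ := hQ
  have hstrong : ∀ r : ℝ, FenchelDuality.primalValue f g A = (r : EReal) →
      ∃ η : StrongDual ℝ Y,
        FenchelDuality.primalValue f g A ≤ FenchelDuality.dualObjective f g A η := fun r hr => by
    rw [hr]
    exact FenchelDuality.exists_le_dualObjective f g A hf.1 hf_conv hg.1 hg_poly hx₀ hgx₀ hr.ge
  have hle : ∀ η, FenchelDuality.dualObjective f g A η ≤ FenchelDuality.dualValue f g A :=
    fun η => le_iSup (FenchelDuality.dualObjective f g A) η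
  refine ⟨?_, fun ⟨r, hr⟩ => ?_⟩
  · refine le_antisymm ?_ hweak
    have htop : FenchelDuality.primalValue f g A ≠ ⊤ :=
      ((iInf_le _ x₀).trans_lt (EReal.add_lt_top (ne_of_lt hx₀.1) (ne_of_lt hgx₀))).ne
    by_cases hbot : FenchelDuality.primalValue f g A = ⊥
    · rw [hbot]; exact bot_le
    · obtain ⟨η, hη⟩ := hstrong _ (EReal.coe_toReal htop hbot).symm
      exact hη.trans (hle η)
  · obtain ⟨η, hη⟩ := hstrong r hr
    exact ⟨η, le_antisymm (hle η) (hweak.trans hη)⟩
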